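/- Call $\varphi:[0,\infty)\to[0,\infty)$ a $\varphi$-function if it is continuous and non-decreasing, $\varphi(0)=0$, $\varphi(u)>0$ for $u>0$, and $\varphi(u)\to+\infty$ as $u\to+\infty$. For a Lebesgue measurable $f:\mathbb R\to\mathbb R$ put $I^\varphi[f]=\int_{\mathbb R}\varphi(|f(x)|)\,dx\in[0,\infty]$; let $L^\varphi(\mathbb R)$ be the set of measurable $f$ with $I^\varphi[cf]<\infty$ for some $c>0$, and for $\lambda>0$, $\delta>0$ put $$\omega(f,\delta)_{\varphi}=\sup_{|t|\le\delta}I^\varphi[\lambda(f(\cdot+t)-f(\cdot))].$$ Let $F(x)=\tfrac12\,\mathrm{sinc}^2(x/2)$ be the Fejér kernel, where $\mathrm{sinc}(x)=\frac{\sin(\pi x)}{\pi x}$ for $x\neq0$ and $\mathrm{sinc}(0)=1$. Let $\psi$ be a $\varphi$-function, let $\theta_0>0$, and let $(g_w)_{w>0}$ be functions $\mathbb R\to\mathbb R$ such that $g_w(u)\to u$ uniformly on $\mathbb R$ as $w\to+\infty$, $|g_w(u)-g_w(v)|\le\psi(|u-v|)$ for all $u,v\in\mathbb R$ and $w>0$,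 and * ($\mathcal L2$) $g_w(0)=0$ for all $w>0$; * ($\mathcal L3$) $\displaystyle\sup_{u\ne0}\Big|\frac{g_w(u)}{u}\sum_{k\in\mathbb Z}F(wx-k)-1\Big|=\mathcal O(w^{-\theta_0})$ as $w\to+\infty$, uniformly in $x\in\mathbb R$. Consider the nonlinear sampling Kantorovich operators with nodes $t_k=k$, $$(S_w^Ff)(x)=\sum_{k\in\mathbb Z}F(wx-k)\,g_w\Big(w\int_{k/w}^{(k+1)/w}f(u)\,du\Big).$$ Let $\varphi$ and $\eta$ be convex $\varphi$-functions satisfying (H): for every $\lambda\in(0,1)$ there is $C_\lambda\in(0,1)$ with $\varphi(C_\lambda\psi(u))\le\eta(\lambda u)$ for all $u\ge0$. Let $f\in L^{\varphi+\eta}(\mathbb R)$. Then $f$ is locally integrable and the series defining $(S_w^Ff)(x)$ converges absolutely for all $w>0$ and $x\in\mathbb R$. Moreover, let $0<\alpha<1$, $0<\nu<1$ and $\alpha_0=(1-\alpha)\nu$. There is a constant $\widetilde K>0$, depending only on $\alpha$ and $\nu$, such that for every $\lambda_0>0$ with $I^{\varphi+\eta}[\lambda_0f]<\infty$ (such $\lambda_0$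 exist) and every $0<\lambda<\min\{1,\lambda_0/2\}$ there is $\mu>0$ such that, for all sufficiently large $w>0$, $$I^\varphi[\mu(S_w^Ff-f)]\le\frac13\Big\{\omega(f,w^{-\alpha})_\eta+\widetilde K\,I^\eta[\lambda_0f]\,w^{-\alpha_0}+\omega(f,1/w)_\eta+I^\varphi[\lambda_0f]\,w^{-\theta_0}\Big\},$$ where $\omega(f,\cdot)_\eta$ is formed with the parameter $\lambda$. -/

import Mathlib

open MeasureTheory Filter Topology
open scoped ENNReal

noncomputable section

/-- A `φ`-function `[0,∞) → [0,∞)`: continuous, zero at `0`, non-decreasing, positive on `(0,∞)`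
and divergent at `+∞`. It is represented by a function on `ℝ`, whose values on the negative
half-line play no role. -/
structure IsPhiFunction (φ : ℝ → ℝ) : Prop where
  continuousOn : ContinuousOn φ (Set.Ici 0)
  map_zero : φ 0 = 0
  monotoneOn : MonotoneOn φ (Set.Ici 0)
  pos : ∀ u, 0 < u → 0 < φ u
  tendsto : Tendsto φ atTop atTop

/-- The modular `I^φ[f] = ∫_ℝ φ(|f(x)|) dx ∈ [0,∞]`. -/
def orliczModular (φ f : ℝ → ℝ) : ℝ≥0∞ :=
  ∫⁻ x, ENNReal.ofReal (φ |f x|)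

/-- Membership in the Orlicz space `L^φ(ℝ)`: `f` is Lebesgue measurable and `I^φ[c f] < ∞` for
some `c > 0`. -/
def MemOrlicz (φ f : ℝ → ℝ) : Prop :=
  AEMeasurable f volume ∧ ∃ c : ℝ, 0 < c ∧ orliczModular φ (fun x => c * f x) < ∞

/-- The modulus of continuity `ω(f,δ)_φ = sup_{|t| ≤ δ} I^φ[lam (f(· + t) - f(·))]` with respect to
the modular `I^φ` and the parameter `lam > 0`. -/
def orliczModulus (φ : ℝ → ℝ) (lam : ℝ) (f : ℝ → ℝ) (δ : ℝ) : ℝ≥0∞ :=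
  ⨆ (t : ℝ) (_ : |t| ≤ δ), orliczModular φ (fun x => lam * (f (x + t) - f x))

/-- Condition (H) linking `φ`, `ψ` and `η`. -/
def ConditionH (φ ψ η : ℝ → ℝ) : Prop :=
  ∀ lam : ℝ, 0 < lam → lam < 1 → ∃ C : ℝ, 0 < C ∧ C < 1 ∧
    ∀ u : ℝ, 0 ≤ u → φ (C * ψ u) ≤ η (lam * u)

/-- The Fejér kernel `F(x) = ½ sinc²(x/2)` with the normalized `sinc(x) = sin(πx)/(πx)`; Mathlib's
`Real.sinc` is `sin(x)/x`. -/
def fejerKernel (x : ℝ) : ℝ :=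
  1 / 2 * Real.sinc (Real.pi * (x / 2)) ^ 2

/-- The term of index `k` of `(S_w^F f)(x)`. -/
def fejerTerm (g : ℝ → ℝ → ℝ) (w : ℝ) (f : ℝ → ℝ) (x : ℝ) (k : ℤ) : ℝ :=
  fejerKernel (w * x - k) * g w (w * ∫ u in ((k : ℝ) / w)..(((k : ℝ) + 1) / w), f u)

/-- The nonlinear sampling Kantorovich operator `S_w^F` based on the Fejér kernel, the uniform
sampling scheme `t_k = k` and the family `(g_w)`. -/
def fejerKantorovich (g : ℝ → ℝ → ℝ) (w : ℝ) (f : ℝ → ℝ) (x : ℝ) : ℝ :=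
  ∑' k : ℤ, fejerTerm g w f x k

/-- `T_w(x) = sup_{u ≠ 0} |(g_w(u)/u) ∑_k F(wx - k) - 1| ∈ [0,∞]`. -/
def fejerDeviation (g : ℝ → ℝ → ℝ) (w x : ℝ) : ℝ≥0∞ :=
  ⨆ (u : ℝ) (_ : u ≠ 0),
    ENNReal.ofReal |g w u / u * ∑' k : ℤ, fejerKernel (w * x - k) - 1|

/-- The assumptions on the family `(g_w)_{w > 0}`. The field `deviation` says that
`T_w(x) = O(w^{-θ₀})` as `w → +∞`, uniformly in `x`. -/
structure IsAdmissibleFamily (g : ℝ → ℝ → ℝ) (ψ : ℝ → ℝ) (θ₀ : ℝ) : Prop where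
  tendstoUniformly : TendstoUniformly g (fun u => u) atTop
  modulus : ∀ w, 0 < w → ∀ u v : ℝ, |g w u - g w v| ≤ ψ |u - v|
  map_zero : ∀ w, 0 < w → g w 0 = 0
  deviation : ∃ M : ℝ, ∀ᶠ w in atTop, ∀ x : ℝ,
    fejerDeviation g w x ≤ ENNReal.ofReal (M * w ^ (-θ₀))

end

/-! Let `b x` be the mean of `f` over `(x, x + 1/w]` and `a k` the sampled means. Inserting `g w (b
x)` and `g w (f x)` splits the error into three terms (`abs_sub_le`), and convexity of `φ` with
weights 1/3 separates their modulars.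

The first term is at most `∑ F(wx - k) ψ|a k - b x|`. Discrete Jensen, (H) and Jensen for means
reduce it to the differences `f (k/w + s) - f (x + s)`, whose displacement `x - k/w` does not depend
on `s`. Integration in `x` then unfolds it to `∫ F(u) J(u/w) du`, with `J t` the `η`-modular of
`λ(f(· + t) - f)` (`lintegral_tsum_fejerKernel_mul_mean`). Splitting at `|u| = w^(1-α)` gives `ω(f,
w^(-α))` plus a kernel tail of order `w^(-(1-α))`.

The second term, controlled by `ψ|b x - f x|`, gives `ω(f, 1/w)` by (H), Jensen and Tonelli. The
third is at most `M w^(-θ₀)|f x|` by (L3), and convexity pulls the factor `w^(-θ₀)` out of `φ`. -/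

/-! ### Convex φ-functions and Jensen inequalities. -/

theorem IsPhiFunction.continuous_abs {φ : ℝ → ℝ} (h : IsPhiFunction φ) :
    Continuous fun x : ℝ => φ |x| :=
  h.continuousOn.comp_continuous _root_.continuous_abs fun x => abs_nonneg x

theorem IsPhiFunction.mono {φ : ℝ → ℝ} (h : IsPhiFunction φ) {a b : ℝ} (ha : 0 ≤ a)
    (hab : a ≤ b) : φ a ≤ φ b :=
  h.monotoneOn ha (ha.trans hab) hab

theorem IsPhiFunction.nonneg {φ : ℝ → ℝ} (h : IsPhiFunction φ) {a : ℝ} (ha : 0 ≤ a) :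
    0 ≤ φ a :=
  h.map_zero ▸ h.mono le_rfl ha

theorem IsPhiFunction.map_mul_le {φ : ℝ → ℝ} (h : IsPhiFunction φ)
    (hc : ConvexOn ℝ (Set.Ici 0) φ) {c x : ℝ} (hc₀ : 0 ≤ c) (hc₁ : c ≤ 1) (hx : 0 ≤ x) :
    φ (c * x) ≤ c * φ x := by
  have := hc.2 (Set.mem_Ici.2 hx) (Set.mem_Ici.2 le_rfl) hc₀ (sub_nonneg.2 hc₁) (by ring)
  simpa [h.map_zero] using this

theorem IsPhiFunction.convexOn_abs {φ : ℝ → ℝ} (h : IsPhiFunction φ)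
    (hc : ConvexOn ℝ (Set.Ici 0) φ) : ConvexOn ℝ Set.univ fun x : ℝ => φ |x| := by
  refine ⟨convex_univ, fun x _ y _ a b ha hb hab => ?_⟩
  refine le_trans (h.mono (abs_nonneg _) ?_)
    (hc.2 (Set.mem_Ici.2 (abs_nonneg x)) (Set.mem_Ici.2 (abs_nonneg y)) ha hb hab)
  simp only [smul_eq_mul]
  calc |a * x + b * y| ≤ |a * x| + |b * y| := abs_add_le _ _
    _ = a * |x| + b * |y| := by rw [abs_mul, abs_mul, abs_of_nonneg ha, abs_of_nonneg hb]

theorem IsPhiFunction.add {φ η : ℝ → ℝ} (hφ : IsPhiFunction φ) (hη : IsPhiFunction η) :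
    IsPhiFunction fun u => φ u + η u where
  continuousOn := hφ.continuousOn.add hη.continuousOn
  map_zero := by simp [hφ.map_zero, hη.map_zero]
  monotoneOn := hφ.monotoneOn.add hη.monotoneOn
  pos u hu := add_pos (hφ.pos u hu) (hη.pos u hu)
  tendsto := hφ.tendsto.atTop_add_atTop hη.tendsto

/-- A convex `φ`-function dominates the identity up to constants. -/
theorem IsPhiFunction.le_one_add {φ : ℝ → ℝ} (h : IsPhiFunction φ)
    (hc : ConvexOn ℝ (Set.Ici 0) φ) {x : ℝ} (hx : 0 ≤ x) : x ≤ 1 + φ x / φ 1 := by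
  have h1 := h.pos 1 one_pos
  rcases le_total x 1 with hx1 | hx1
  · have := div_nonneg (h.nonneg hx) h1.le
    linarith
  · have hx0 : 0 < x := by linarith
    -- Contracting `x` to 1 gives `φ 1 ≤ φ x / x`.
    have := h.map_mul_le hc (inv_nonneg.2 hx) (inv_le_one_of_one_le₀ hx1) hx
    rw [inv_mul_cancel₀ hx0.ne', inv_mul_eq_div, le_div_iff₀ hx0] at this
    have : x ≤ φ x / φ 1 := by rw [le_div_iff₀ h1]; linarith
    linarith

/-- Jensen's inequality for convex `φ`-functions, with no integrability of `φ ∘ |h|`. -/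
theorem IsPhiFunction.ofReal_map_abs_integral_le {X : Type*} [MeasurableSpace X] {P : Measure X}
    [IsProbabilityMeasure P] {η : ℝ → ℝ} (hη : IsPhiFunction η) (hc : ConvexOn ℝ (Set.Ici 0) η)
    {h : X → ℝ} (hh : Integrable h P) :
    ENNReal.ofReal (η |∫ x, h x ∂P|) ≤ ∫⁻ x, ENNReal.ofReal (η |h x|) ∂P := by
  by_cases hfin : ∫⁻ x, ENNReal.ofReal (η |h x|) ∂P = ∞
  · simp [hfin]
  have hm : AEStronglyMeasurable (fun x => η |h x|) P :=
    hη.continuous_abs.comp_aestronglyMeasurable hh.1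
  have hint : Integrable (fun x => η |h x|) P :=
    (lintegral_ofReal_ne_top_iff_integrable hm
      (Eventually.of_forall fun x => hη.nonneg (abs_nonneg _))).1 hfin
  rw [← ofReal_integral_eq_lintegral_ofReal hint
    (Eventually.of_forall fun x => hη.nonneg (abs_nonneg _))]
  exact ENNReal.ofReal_le_ofReal ((hη.convexOn_abs hc).map_integral_le
    hη.continuous_abs.continuousOn isClosed_univ (by simp) hh hint)

/-- Jensen's inequality for the mean over `(0, 1/w]`. -/
theorem IsPhiFunction.ofReal_map_mean_le {η : ℝ → ℝ} (hη : IsPhiFunction η)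
    (hc : ConvexOn ℝ (Set.Ici 0) η) {w : ℝ} (hw : 0 < w) {h : ℝ → ℝ}
    (hh : IntegrableOn h (Set.Ioc 0 (1 / w))) (lam : ℝ) :
    ENNReal.ofReal (η |lam * (w * ∫ s in (0 : ℝ)..1 / w, h s)|) ≤
      ENNReal.ofReal w * ∫⁻ s in Set.Ioc 0 (1 / w), ENNReal.ofReal (η |lam * h s|) := by
  let P : Measure ℝ := ENNReal.ofReal w • volume.restrict (Set.Ioc 0 (1 / w))
  have : IsProbabilityMeasure P := ⟨by
    simp only [P, Measure.smul_apply, Measure.restrict_apply_univ, Real.volume_Ioc, smul_eq_mul,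
      sub_zero]
    rw [← ENNReal.ofReal_mul hw.le, mul_one_div_cancel hw.ne', ENNReal.ofReal_one]⟩
  have hint : Integrable (fun s => lam * h s) P :=
    (Integrable.const_mul hh lam).smul_measure ENNReal.ofReal_ne_top
  have := hη.ofReal_map_abs_integral_le hc hint
  simp only [P, integral_smul_measure, lintegral_smul_measure, ENNReal.toReal_ofReal hw.le,
    smul_eq_mul, integral_const_mul] at this
  rw [intervalIntegral.integral_of_le (by positivity)]
  convert this using 3

/-- Jensen's inequality for countably many weights of total mass at most `N`. -/
theorem IsPhiFunction.ofReal_map_tsum_le {φ : ℝ → ℝ} (h : IsPhiFunction φ)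
    (hc : ConvexOn ℝ (Set.Ici 0) φ) {c a : ℤ → ℝ} {N : ℝ} (hN : 0 < N) (hc₀ : ∀ k, 0 ≤ c k)
    (hcs : Summable c) (hcN : ∑' k, c k ≤ N) (ha : ∀ k, 0 ≤ a k)
    (hs : Summable fun k => c k * a k) {r : ℝ} (hr : 0 ≤ r) :
    ENNReal.ofReal (φ (r * ∑' k, c k * a k)) ≤
      ENNReal.ofReal N⁻¹ * ∑' k, ENNReal.ofReal (c k) * ENNReal.ofReal (φ (r * N * a k)) := by
  have key : ∀ t : Finset ℤ, ENNReal.ofReal (φ (r * ∑ k ∈ t, c k * a k)) ≤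
      ENNReal.ofReal N⁻¹ * ∑' k, ENNReal.ofReal (c k) * ENNReal.ofReal (φ (r * N * a k)) := by
    intro t
    have hle : ∑ k ∈ t, N⁻¹ * c k ≤ 1 := by
      rw [← Finset.mul_sum, inv_mul_le_iff₀ hN, mul_one]
      exact (hcs.sum_le_tsum t fun k _ => hc₀ k).trans hcN
    -- The normalized weights may sum to less than 1; the missing mass sits at 0, where `φ`
    -- vanishes. The infinite sum then follows by continuity of `φ`.
    have hJ := hc.map_add_sum_le (t := t) (w := fun k => N⁻¹ * c k)
      (p := fun k => r * N * a k) (v := 1 - ∑ k ∈ t, N⁻¹ * c k) (q := 0)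
      (fun k _ => mul_nonneg (inv_nonneg.2 hN.le) (hc₀ k)) (by ring)
      (fun k _ => Set.mem_Ici.2 (mul_nonneg (mul_nonneg hr hN.le) (ha k))) (by linarith)
      (Set.mem_Ici.2 le_rfl)
    simp only [smul_eq_mul, mul_zero, zero_add, h.map_zero] at hJ
    have e1 : ∑ k ∈ t, N⁻¹ * c k * (r * N * a k) = r * ∑ k ∈ t, c k * a k := by
      rw [Finset.mul_sum]
      exact Finset.sum_congr rfl fun k _ => by field_simp
    rw [e1] at hJ
    refine (ENNReal.ofReal_le_ofReal hJ).trans ?_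
    rw [← ENNReal.tsum_mul_left, ENNReal.ofReal_sum_of_nonneg fun k _ => mul_nonneg
      (mul_nonneg (inv_nonneg.2 hN.le) (hc₀ k))
      (h.nonneg (mul_nonneg (mul_nonneg hr hN.le) (ha k)))]
    refine le_trans (le_of_eq ?_) (ENNReal.sum_le_tsum t)
    refine Finset.sum_congr rfl fun k _ => ?_
    rw [ENNReal.ofReal_mul (mul_nonneg (inv_nonneg.2 hN.le) (hc₀ k)),
      ENNReal.ofReal_mul (inv_nonneg.2 hN.le), mul_assoc]
  have hpos : ∀ t : Finset ℤ, 0 ≤ r * ∑ k ∈ t, c k * a k := fun t =>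
    mul_nonneg hr (Finset.sum_nonneg fun k _ => mul_nonneg (hc₀ k) (ha k))
  have hpos' : 0 ≤ r * ∑' k, c k * a k :=
    mul_nonneg hr (tsum_nonneg fun k => mul_nonneg (hc₀ k) (ha k))
  have hlim := (ENNReal.continuous_ofReal.comp h.continuous_abs).continuousAt.tendsto.comp
    (hs.hasSum.const_smul r : Tendsto _ _ _)
  rw [Function.comp_apply, smul_eq_mul, abs_of_nonneg hpos'] at hlim
  refine le_of_tendsto hlim (Eventually.of_forall fun t => ?_)
  have := key t
  simp only [Function.comp_apply, smul_eq_mul, ← Finset.mul_sum]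
  rwa [abs_of_nonneg (hpos t)]

/-! ### Modulars and local integrability. -/

theorem orliczModular_congr {φ f f' : ℝ → ℝ} (h : f =ᵐ[volume] f') :
    orliczModular φ f = orliczModular φ f' :=
  lintegral_congr_ae (h.mono fun x hx => by simp only [hx])

/-- By the linear growth in `le_one_add`, `|f|` is dominated by a constant plus an integrable
function. -/
theorem IsPhiFunction.locallyIntegrable {φ f : ℝ → ℝ} (hφ : IsPhiFunction φ)
    (hc : ConvexOn ℝ (Set.Ici 0) φ) (hf : MemOrlicz φ f) : LocallyIntegrable f volume := by
  obtain ⟨hm, c, hc₀, hfin⟩ := hf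
  have hm' : AEStronglyMeasurable (fun x => φ |c * f x|) volume :=
    hφ.continuous_abs.comp_aestronglyMeasurable (hm.aestronglyMeasurable.const_mul c)
  have hint : Integrable (fun x => φ |c * f x|) volume :=
    (lintegral_ofReal_ne_top_iff_integrable hm'
      (Eventually.of_forall fun x => hφ.nonneg (abs_nonneg _))).1 hfin.ne
  have hdom : LocallyIntegrable (fun x => c⁻¹ * (1 + φ |c * f x| / φ 1)) volume :=
    LocallyIntegrable.smul ((locallyIntegrable_const (1 : ℝ)).add
      (hint.div_const (φ 1)).locallyIntegrable) c⁻¹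
  refine hdom.mono hm.aestronglyMeasurable (Eventually.of_forall fun x => ?_)
  rw [Real.norm_eq_abs, Real.norm_eq_abs]
  refine le_trans ?_ (le_abs_self _)
  rw [le_inv_mul_iff₀ hc₀]
  have := hφ.le_one_add hc (abs_nonneg (c * f x))
  rwa [abs_mul c, abs_of_pos hc₀] at this ⊢

/-! ### Fejér kernel: pointwise decay, discrete sums, total mass and tails. -/

theorem fejerKernel_nonneg (x : ℝ) : 0 ≤ fejerKernel x := by
  unfold fejerKernel; positivity

theorem continuous_fejerKernel : Continuous fejerKernel := by
  unfold fejerKernel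
  have := Real.continuous_sinc
  fun_prop

/-- Combines `|sinc| ≤ 1` with `y² sinc² y = sin² y ≤ 1` and `π² ≥ 9`. The majorant has primitive
`arctan` and is summable over the integers, so it serves both the integrals and the series. -/
theorem fejerKernel_le (x : ℝ) : fejerKernel x ≤ (1 + x ^ 2)⁻¹ := by
  unfold fejerKernel
  set y := Real.pi * (x / 2) with hy
  have h1 : Real.sinc y ^ 2 ≤ 1 := (sq_le_one_iff_abs_le_one _).2 (Real.abs_sinc_le_one y)
  rw [← one_div, le_div_iff₀ (by positivity)]
  have h2 : y ^ 2 * Real.sinc y ^ 2 ≤ 1 := by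
    rcases eq_or_ne y 0 with h | h
    · simp [h]
    · rw [Real.sinc_of_ne_zero h, div_pow, mul_div_cancel₀ _ (pow_ne_zero 2 h)]
      exact Real.sin_sq_le_one y
  have hpi : (9 : ℝ) ≤ Real.pi ^ 2 := by nlinarith [Real.pi_gt_three]
  have h3 : y ^ 2 = Real.pi ^ 2 * x ^ 2 / 4 := by rw [hy]; ring
  have h4 : x ^ 2 * Real.sinc y ^ 2 ≤ 1 := by
    have : 0 ≤ x ^ 2 * Real.sinc y ^ 2 := by positivity
    nlinarith
  nlinarith

theorem summable_inv_one_add_int_sq : Summable fun k : ℤ => (1 + (k : ℝ) ^ 2)⁻¹ := by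
  have h : Summable fun k : ℤ => ((k : ℝ) ^ 2)⁻¹ := by
    simpa using (Real.summable_one_div_int_pow (p := 2)).2 one_lt_two
  refine (h.add (summable_of_ne_finset_zero (f := fun k : ℤ => if k = 0 then (1 : ℝ) else 0)
    (s := {0}) (by simp))).of_nonneg_of_le (fun k => by positivity) fun k => ?_
  rcases eq_or_ne k 0 with rfl | hk
  · simp
  · have : (0 : ℝ) < (k : ℝ) ^ 2 := by positivity
    simp only [hk, if_false, add_zero]
    exact inv_anti₀ this (by linarith)

/-- A bound for the discrete moment `sup_u ∑_k F(u - k)`. -/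
noncomputable def fejerBound : ℝ := 4 * ∑' k : ℤ, (1 + (k : ℝ) ^ 2)⁻¹

/-- The value 4 also bounds the integral of the kernel, so the factor `fejerBound⁻¹` from discrete
Jensen absorbs that integral and leaves coefficient 1 on the modulus of continuity. -/
theorem four_le_fejerBound : 4 ≤ fejerBound := by
  have := summable_inv_one_add_int_sq.le_tsum 0 fun k _ => by positivity
  unfold fejerBound
  norm_num at this ⊢
  linarith

/-- Centring the index at `⌊u⌋` leaves an offset in `[0, 1)`, which costs a factor 4 and makes the
bound uniform in `u`. -/
theorem fejerKernel_shift_le (u : ℝ) (k : ℤ) :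
    fejerKernel (u - ((k + ⌊u⌋ : ℤ) : ℝ)) ≤ 4 * (1 + (k : ℝ) ^ 2)⁻¹ := by
  refine (fejerKernel_le _).trans ?_
  have h0 := Int.fract_nonneg u
  have h1 := (Int.fract_lt_one u).le
  have e : u - ((k + ⌊u⌋ : ℤ) : ℝ) = Int.fract u - k := by
    push_cast; rw [← Int.self_sub_floor]; ring
  rw [e, ← div_eq_mul_inv, ← one_div, div_le_div_iff₀ (by positivity) (by positivity)]
  nlinarith [sq_nonneg (2 * Int.fract u - k)]

theorem summable_fejerKernel (u : ℝ) : Summable fun k : ℤ => fejerKernel (u - k) := by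
  rw [← (Equiv.addRight ⌊u⌋).summable_iff]
  exact (summable_inv_one_add_int_sq.mul_left 4).of_nonneg_of_le
    (fun k => fejerKernel_nonneg _) (fejerKernel_shift_le u)

theorem tsum_fejerKernel_le (u : ℝ) : ∑' k : ℤ, fejerKernel (u - k) ≤ fejerBound := by
  rw [← (Equiv.addRight ⌊u⌋).tsum_eq, fejerBound, ← tsum_mul_left]
  exact Summable.tsum_le_tsum (fejerKernel_shift_le u)
    ((Equiv.addRight ⌊u⌋).summable_iff.2 (summable_fejerKernel u))
    (summable_inv_one_add_int_sq.mul_left 4)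

theorem lintegral_fejerKernel_le : ∫⁻ t, ENNReal.ofReal (fejerKernel t) ≤ 4 := by
  calc ∫⁻ t, ENNReal.ofReal (fejerKernel t)
      ≤ ∫⁻ t : ℝ, ENNReal.ofReal ((1 + t ^ 2)⁻¹) :=
        lintegral_mono fun t => ENNReal.ofReal_le_ofReal (fejerKernel_le t)
    _ = ENNReal.ofReal Real.pi := by
        rw [← ofReal_integral_eq_lintegral_ofReal integrable_inv_one_add_sq
          (Eventually.of_forall fun t => by positivity), integral_univ_inv_one_add_sq]
    _ ≤ 4 := by
        simpa using ENNReal.ofReal_le_ofReal Real.pi_le_four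

/-- Each half-line contributes `π/2 - arctan R = arctan (1/R) ≤ 1/R`. The resulting 2 is the
constant of the final estimate. -/
theorem lintegral_fejerKernel_tail_le {R : ℝ} (hR : 0 < R) :
    ∫⁻ t in {t : ℝ | |t| ≤ R}ᶜ, ENNReal.ofReal (fejerKernel t) ≤ ENNReal.ofReal (2 / R) := by
  have hsub : {t : ℝ | |t| ≤ R}ᶜ ⊆ Set.Iic (-R) ∪ Set.Ioi R := by
    intro t ht
    simp only [Set.mem_compl_iff, Set.mem_ofPred_eq, not_le, lt_abs] at ht
    rcases ht with h | h
    · exact Or.inr h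
    · exact Or.inl (Set.mem_Iic.2 (by linarith))
  have hat : Real.pi / 2 - Real.arctan R ≤ 1 / R := by
    rw [← Real.arctan_inv_of_pos hR, ← one_div]
    have h0 : 0 < 1 / R := by positivity
    have := Real.lt_tan (Real.arctan_pos.2 h0) (Real.arctan_lt_pi_div_two _)
    rw [Real.tan_arctan] at this
    exact this.le
  have hpart : ∀ s : Set ℝ, ∫⁻ t in s, ENNReal.ofReal (fejerKernel t) ≤
      ENNReal.ofReal (∫ t in s, (1 + t ^ 2)⁻¹) := fun s => by
    rw [ofReal_integral_eq_lintegral_ofReal integrable_inv_one_add_sq.integrableOn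
      (Eventually.of_forall fun t => by positivity)]
    exact lintegral_mono fun t => ENNReal.ofReal_le_ofReal (fejerKernel_le t)
  calc ∫⁻ t in {t : ℝ | |t| ≤ R}ᶜ, ENNReal.ofReal (fejerKernel t)
      ≤ ∫⁻ t in Set.Iic (-R) ∪ Set.Ioi R, ENNReal.ofReal (fejerKernel t) :=
        lintegral_mono_set hsub
    _ ≤ _ := lintegral_union_le _ _ _
    _ ≤ ENNReal.ofReal (1 / R) + ENNReal.ofReal (1 / R) := by
        refine add_le_add ((hpart _).trans (ENNReal.ofReal_le_ofReal ?_))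
          ((hpart _).trans (ENNReal.ofReal_le_ofReal ?_))
        · rw [integral_Iic_inv_one_add_sq, Real.arctan_neg]; linarith
        · rw [integral_Ioi_inv_one_add_sq]; exact hat
    _ = ENNReal.ofReal (2 / R) := by
        rw [← ENNReal.ofReal_add (by positivity) (by positivity)]; ring_nf

/-! ### Scaling, tiling and unfolding of integrals. -/

theorem lintegral_comp_mul_left_real {w : ℝ} (hw : 0 < w) (G : ℝ → ℝ≥0∞) :
    ENNReal.ofReal w * ∫⁻ t, G (w * t) = ∫⁻ s, G s := by
  have := (Homeomorph.mulLeft₀ w hw.ne').measurableEmbedding.lintegral_map (μ := volume) G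
  simp only [Homeomorph.coe_mulLeft₀] at this
  rw [← this, ← smul_eq_mul, ← lintegral_smul_measure]
  conv_rhs => rw [← Real.smul_map_volume_mul_left hw.ne', abs_of_pos hw]

theorem tsum_setLIntegral_Ioc {w : ℝ} (hw : 0 < w) (G : ℝ → ℝ≥0∞) :
    ∑' k : ℤ, ∫⁻ s in Set.Ioc 0 (1 / w), G (k / w + s) = ∫⁻ y, G y := by
  have hw' : 0 < 1 / w := by positivity
  have hU : ⋃ n : ℤ, Set.Ioc (0 + n • (1 / w)) (0 + (n + 1) • (1 / w)) = Set.univ :=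
    iUnion_Ioc_add_zsmul hw' 0
  rw [← setLIntegral_univ, ← hU, lintegral_iUnion (fun n => measurableSet_Ioc)
    (Set.pairwise_disjoint_Ioc_add_zsmul (0 : ℝ) (1 / w))]
  refine tsum_congr fun k => ?_
  rw [(measurePreserving_add_left volume ((k : ℝ) / w)).setLIntegral_comp_emb
    (MeasurableEquiv.addLeft ((k : ℝ) / w)).measurableEmbedding G]
  congr 2
  simp only [Set.image_const_add_Ioc, zsmul_eq_mul]
  push_cast
  congr 1 <;> ring

/-- Unfolding: summing over the sampling nodes turns the local means into an integral over `ℝ`. -/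
theorem lintegral_tsum_fejerKernel_mul_mean {w : ℝ} (hw : 0 < w) {H : ℝ → ℝ → ℝ≥0∞}
    (hH : Measurable (Function.uncurry H)) :
    ∫⁻ x, ∑' k : ℤ, ENNReal.ofReal (fejerKernel (w * x - k)) *
        (ENNReal.ofReal w * ∫⁻ s in Set.Ioc 0 (1 / w), H (k / w + s) (x + s)) =
      ∫⁻ u, ENNReal.ofReal (fejerKernel u) * ∫⁻ y, H y (y + u / w) := by
  have hF := continuous_fejerKernel.measurable
  have hmeas : ∀ k : ℤ, Measurable fun x : ℝ =>
      ∫⁻ s in Set.Ioc 0 (1 / w), H (k / w + s) (x + s) := fun k => by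
    have : Measurable fun p : ℝ × ℝ => H (k / w + p.2) (p.1 + p.2) :=
      hH.comp (by fun_prop : Measurable fun p : ℝ × ℝ => ((k : ℝ) / w + p.2, p.1 + p.2))
    exact this.lintegral_prod_right'
  have hmeas' : ∀ k : ℤ, Measurable fun x : ℝ => ENNReal.ofReal (fejerKernel (w * x - k)) *
      (ENNReal.ofReal w * ∫⁻ s in Set.Ioc 0 (1 / w), H (k / w + s) (x + s)) := fun k =>
    (hF.comp (by fun_prop)).ennreal_ofReal.mul ((hmeas k).const_mul _)
  -- Translating the `k`-th integral by `k/w` makes its kernel factor `F(wx)` for every `k`. The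
  -- intervals of length `1/w` then tile the line.
  have hshift : ∀ k : ℤ, ∫⁻ x, ENNReal.ofReal (fejerKernel (w * x - k)) *
        (ENNReal.ofReal w * ∫⁻ s in Set.Ioc 0 (1 / w), H (k / w + s) (x + s)) =
      ∫⁻ x, ENNReal.ofReal (fejerKernel (w * (x + k / w) - k)) *
        (ENNReal.ofReal w * ∫⁻ s in Set.Ioc 0 (1 / w), H (k / w + s) (x + k / w + s)) :=
    fun k => (lintegral_add_right_eq_self (μ := volume) (fun x : ℝ =>
      ENNReal.ofReal (fejerKernel (w * x - k)) *
        (ENNReal.ofReal w * ∫⁻ s in Set.Ioc 0 (1 / w), H (k / w + s) (x + s))) (k / w)).symm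
  have hmeas_shift : ∀ k : ℤ, Measurable fun x : ℝ =>
      ENNReal.ofReal (fejerKernel (w * (x + k / w) - k)) *
        (ENNReal.ofReal w * ∫⁻ s in Set.Ioc 0 (1 / w), H (k / w + s) (x + k / w + s)) :=
    fun k => (hmeas' k).comp (measurable_add_const _)
  rw [lintegral_tsum fun k => (hmeas' k).aemeasurable, tsum_congr hshift,
    ← lintegral_tsum fun k => (hmeas_shift k).aemeasurable,
    ← lintegral_comp_mul_left_real hw fun u => ENNReal.ofReal (fejerKernel u) * ∫⁻ y, H y (y + u / w),
    ← lintegral_const_mul' _ _ ENNReal.ofReal_ne_top]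
  refine lintegral_congr fun x => ?_
  have e1 : ∀ k : ℤ, w * (x + k / w) - k = w * x := fun k => by field_simp; ring
  have e2 : w * x / w = x := by field_simp
  simp only [e1, e2]
  rw [ENNReal.tsum_mul_left, ENNReal.tsum_mul_left, ← tsum_setLIntegral_Ioc hw]
  rw [mul_left_comm]
  congr! 7 with k s
  ring

/-! ### Sampled means and convergence of the series. -/

theorem mean_eq_mean_shift (f : ℝ → ℝ) (w : ℝ) (k : ℤ) :
    ∫ u in ((k : ℝ) / w)..(((k : ℝ) + 1) / w), f u =
      ∫ s in (0 : ℝ)..1 / w, f (k / w + s) := by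
  rw [intervalIntegral.integral_comp_add_left]
  congr 1 <;> ring

theorem LocallyIntegrable.integrableOn_Ioc_shift {f : ℝ → ℝ} (hf : LocallyIntegrable f volume)
    (a r : ℝ) : IntegrableOn (fun s => f (a + s)) (Set.Ioc 0 r) := by
  have h := (hf.integrableOn_isCompact (isCompact_Icc (a := a + 0) (b := a + r))).mono_set
    Set.Ioc_subset_Icc_self
  rw [← Set.image_const_add_Ioc] at h
  exact ((measurePreserving_add_left volume a).integrableOn_image
    (MeasurableEquiv.addLeft a).measurableEmbedding).1 h

/-- The sampled means of a function with finite modular are bounded. -/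
theorem IsPhiFunction.exists_mean_le {η f : ℝ → ℝ} (hη : IsPhiFunction η)
    (hc : ConvexOn ℝ (Set.Ici 0) η) (hf : LocallyIntegrable f volume) {c : ℝ} (hc₀ : 0 < c)
    (hfin : orliczModular η (fun x => c * f x) < ∞) {w : ℝ} (hw : 0 < w) :
    ∃ A : ℝ, 0 ≤ A ∧ ∀ k : ℤ, |w * ∫ u in ((k : ℝ) / w)..(((k : ℝ) + 1) / w), f u| ≤ A := by
  set B := ENNReal.ofReal w * orliczModular η (fun x => c * f x) with hB
  have hBfin : B ≠ ∞ := ENNReal.mul_ne_top ENNReal.ofReal_ne_top hfin.ne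
  -- Jensen bounds `η (c |mean|)` by `B`; since `η` is unbounded and monotone, `c |mean|` cannot
  -- exceed a point `U` where `η` is already above `B`.
  obtain ⟨U, hU₀, hU⟩ := ((eventually_ge_atTop (0 : ℝ)).and
    (hη.tendsto.eventually_gt_atTop B.toReal)).exists
  refine ⟨U / c, by positivity, fun k => ?_⟩
  rw [mean_eq_mean_shift]
  have h1 := hη.ofReal_map_mean_le hc hw
    (LocallyIntegrable.integrableOn_Ioc_shift hf (k / w) (1 / w)) c
  have h2 : ∫⁻ s in Set.Ioc 0 (1 / w), ENNReal.ofReal (η |c * f (k / w + s)|) ≤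
      orliczModular η (fun x => c * f x) :=
    (setLIntegral_le_lintegral _ _).trans
      (lintegral_add_left_eq_self (fun y => ENNReal.ofReal (η |c * f y|)) ((k : ℝ) / w)).le
  have h3 := h1.trans (mul_le_mul_right h2 _)
  rw [← hB, ENNReal.ofReal_le_iff_le_toReal hBfin, abs_mul c, abs_of_pos hc₀] at h3
  rw [le_div_iff₀ hc₀, mul_comm]
  by_contra! hlt
  exact absurd (hη.mono hU₀ hlt.le) (by linarith)

/-- Comparing `g w` with its value 0 at 0 bounds it by `ψ A` on the sampled means, so the kernel
series is a majorant. -/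
theorem IsAdmissibleFamily.summable_fejerTerm {g : ℝ → ℝ → ℝ} {ψ η f : ℝ → ℝ} {θ₀ : ℝ}
    (hg : IsAdmissibleFamily g ψ θ₀) (hψ : IsPhiFunction ψ) (hη : IsPhiFunction η)
    (hc : ConvexOn ℝ (Set.Ici 0) η) (hf : LocallyIntegrable f volume) {c : ℝ} (hc₀ : 0 < c)
    (hfin : orliczModular η (fun x => c * f x) < ∞) {w : ℝ} (hw : 0 < w) (x : ℝ) :
    Summable (fejerTerm g w f x) := by
  obtain ⟨A, hA, h⟩ := hη.exists_mean_le hc hf hc₀ hfin hw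
  refine ((summable_fejerKernel (w * x)).mul_right (ψ A)).of_norm_bounded fun k => ?_
  rw [fejerTerm, norm_mul, Real.norm_eq_abs, Real.norm_eq_abs, abs_of_nonneg (fejerKernel_nonneg _)]
  refine mul_le_mul_of_nonneg_left ?_ (fejerKernel_nonneg _)
  have := hg.modulus w hw (w * ∫ u in ((k : ℝ) / w)..(((k : ℝ) + 1) / w), f u) 0
  rw [hg.map_zero w hw, sub_zero, sub_zero] at this
  exact this.trans (hψ.mono (abs_nonneg _) (h k))

/-! ### Splitting of the error and modular estimates of its terms. -/

/-- The three-term splitting of the approximation error. -/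
theorem IsAdmissibleFamily.abs_sub_le {g : ℝ → ℝ → ℝ} {ψ f : ℝ → ℝ} {θ₀ : ℝ}
    (hg : IsAdmissibleFamily g ψ θ₀) (hψ : IsPhiFunction ψ) {w : ℝ} (hw : 0 < w)
    {A : ℝ} (hA : ∀ k : ℤ, |w * ∫ u in ((k : ℝ) / w)..(((k : ℝ) + 1) / w), f u| ≤ A)
    {ε : ℝ} (x b : ℝ) (hε : ∀ u : ℝ, u ≠ 0 →
      |g w u / u * ∑' k : ℤ, fejerKernel (w * x - k) - 1| ≤ ε) :
    Summable (fun k : ℤ => fejerKernel (w * x - k) *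
        ψ |(w * ∫ u in ((k : ℝ) / w)..(((k : ℝ) + 1) / w), f u) - b|) ∧
    |fejerKantorovich g w f x - f x| ≤
      (∑' k : ℤ, fejerKernel (w * x - k) *
        ψ |(w * ∫ u in ((k : ℝ) / w)..(((k : ℝ) + 1) / w), f u) - b|)
      + fejerBound * ψ |b - f x| + ε * |f x| := by
  set a : ℤ → ℝ := fun k => w * ∫ u in ((k : ℝ) / w)..(((k : ℝ) + 1) / w), f u with ha
  set c : ℤ → ℝ := fun k => fejerKernel (w * x - k) with hc
  have hc₀ : ∀ k, 0 ≤ c k := fun k => fejerKernel_nonneg _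
  have hcs : Summable c := summable_fejerKernel _
  have hs : Summable fun k => c k * ψ |a k - b| := by
    refine (hcs.mul_right (ψ (A + |b|))).of_nonneg_of_le
      (fun k => mul_nonneg (hc₀ k) (hψ.nonneg (abs_nonneg _))) fun k => ?_
    exact mul_le_mul_of_nonneg_left (hψ.mono (abs_nonneg _)
      ((abs_sub _ _).trans (add_le_add_left (hA k) _))) (hc₀ k)
  have hbd : ∀ k, ‖c k * (g w (a k) - g w b)‖ ≤ c k * ψ |a k - b| := fun k => by
    rw [norm_mul, Real.norm_eq_abs, Real.norm_eq_abs, abs_of_nonneg (hc₀ k)]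
    exact mul_le_mul_of_nonneg_left (hg.modulus w hw _ _) (hc₀ k)
  have hs' : Summable fun k => c k * (g w (a k) - g w b) := hs.of_norm_bounded hbd
  refine ⟨hs, ?_⟩
  have hsplit : fejerKantorovich g w f x - f x =
      ∑' k, c k * (g w (a k) - g w b) + (∑' k, c k) * (g w b - g w (f x))
        + ((∑' k, c k) * g w (f x) - f x) := by
    have : fejerKantorovich g w f x = ∑' k, (c k * (g w (a k) - g w b) + c k * g w b) :=
      tsum_congr fun k => by rw [fejerTerm]; ring
    rw [this, hs'.tsum_add (hcs.mul_right _), tsum_mul_right]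
    ring
  have hc0 : 0 ≤ ∑' k, c k := tsum_nonneg hc₀
  -- The deviation bound concerns `g w u / u` with `u ≠ 0`; at `f x = 0` both sides vanish because
  -- `g w 0 = 0`.
  have h3 : |(∑' k, c k) * g w (f x) - f x| ≤ ε * |f x| := by
    rcases eq_or_ne (f x) 0 with h | h
    · simp [h, hg.map_zero w hw]
    · calc |(∑' k, c k) * g w (f x) - f x|
          = |g w (f x) / f x * (∑' k, c k) - 1| * |f x| := by
            rw [← abs_mul]; congr 1; field_simp
        _ ≤ ε * |f x| := mul_le_mul_of_nonneg_right (hε _ h) (abs_nonneg _)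
  rw [hsplit]
  refine (abs_add_three _ _ _).trans (add_le_add_three
    (tsum_of_norm_bounded hs.hasSum hbd) ?_ h3)
  rw [abs_mul, abs_of_nonneg hc0]
  exact mul_le_mul (tsum_fejerKernel_le _) (hg.modulus w hw _ _) (abs_nonneg _)
    (hc0.trans (tsum_fejerKernel_le _))

/-- Source of the factor 1/3 in the theorem, paid for by the factors 3 in the conditions on `μ`. -/
theorem IsPhiFunction.map_add_three_le {φ : ℝ → ℝ} (hφ : IsPhiFunction φ)
    (hc : ConvexOn ℝ (Set.Ici 0) φ) {y p q r : ℝ} (hy : 0 ≤ y) (hp : 0 ≤ p) (hq : 0 ≤ q)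
    (hr : 0 ≤ r) (h : y ≤ p + q + r) :
    ENNReal.ofReal (φ y) ≤ (1 / 3 : ℝ≥0∞) * (ENNReal.ofReal (φ (3 * p)) +
      ENNReal.ofReal (φ (3 * q)) + ENNReal.ofReal (φ (3 * r))) := by
  have hJ := hc.map_sum_le (t := Finset.univ) (w := fun _ : Fin 3 => (1 / 3 : ℝ))
    (p := ![3 * p, 3 * q, 3 * r]) (by intros; norm_num) (by norm_num)
    (by intro i _; fin_cases i <;> simp <;> assumption)
  simp only [Fin.sum_univ_three, smul_eq_mul, Matrix.cons_val_zero, Matrix.cons_val_one,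
    Matrix.cons_val] at hJ
  have e : 1 / 3 * (3 * p) + 1 / 3 * (3 * q) + 1 / 3 * (3 * r) = p + q + r := by ring
  rw [e] at hJ
  have h1 := hφ.nonneg (mul_nonneg zero_le_three hp)
  have h2 := hφ.nonneg (mul_nonneg zero_le_three hq)
  have h3 := hφ.nonneg (mul_nonneg zero_le_three hr)
  have e3 : (1 / 3 : ℝ≥0∞) = ENNReal.ofReal (1 / 3) := by
    rw [ENNReal.ofReal_div_of_pos (by norm_num)]; simp
  rw [e3, ← ENNReal.ofReal_add h1 h2, ← ENNReal.ofReal_add (add_nonneg h1 h2) h3,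
    ← ENNReal.ofReal_mul (by norm_num)]
  exact ENNReal.ofReal_le_ofReal (((hφ.mono hy h).trans hJ).trans_eq (by ring))

/-- The modular of a translation difference is at most that of twice the function. -/
theorem IsPhiFunction.orliczModular_sub_le {η f : ℝ → ℝ} (hη : IsPhiFunction η)
    (hc : ConvexOn ℝ (Set.Ici 0) η) (hf : Measurable f) {lam lam₀ : ℝ} (h₀ : 0 ≤ lam)
    (h : lam ≤ lam₀ / 2) (t : ℝ) :
    orliczModular η (fun x => lam * (f (x + t) - f x)) ≤
      orliczModular η (fun x => lam₀ * f x) := by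
  have hm : Measurable fun x => ENNReal.ofReal (η |lam₀ * f x|) :=
    (hη.continuous_abs.measurable.comp (hf.const_mul lam₀)).ennreal_ofReal
  -- Convexity at the midpoint: this is where `lam ≤ lam₀ / 2` is needed. Translation invariance
  -- then merges the two halves.
  have hpt : ∀ x, ENNReal.ofReal (η |lam * (f (x + t) - f x)|) ≤
      ENNReal.ofReal (1 / 2) * ENNReal.ofReal (η |lam₀ * f (x + t)|) +
        ENNReal.ofReal (1 / 2) * ENNReal.ofReal (η |lam₀ * f x|) := fun x => by
    rw [← ENNReal.ofReal_mul (by norm_num), ← ENNReal.ofReal_mul (by norm_num),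
      ← ENNReal.ofReal_add (mul_nonneg (by norm_num) (hη.nonneg (abs_nonneg _)))
        (mul_nonneg (by norm_num) (hη.nonneg (abs_nonneg _)))]
    refine ENNReal.ofReal_le_ofReal (le_trans (hη.mono (abs_nonneg _) ?_)
      (hc.2 (Set.mem_Ici.2 (abs_nonneg _)) (Set.mem_Ici.2 (abs_nonneg _))
        (by norm_num) (by norm_num) (by norm_num)))
    rw [abs_mul, abs_mul, abs_mul, abs_of_nonneg h₀, abs_of_nonneg (by linarith : 0 ≤ lam₀),
      smul_eq_mul, smul_eq_mul]
    calc lam * |f (x + t) - f x| ≤ lam₀ / 2 * (|f (x + t)| + |f x|) :=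
          mul_le_mul h (abs_sub _ _) (abs_nonneg _) (by linarith)
      _ = _ := by ring
  refine (lintegral_mono hpt).trans ?_
  rw [lintegral_add_right _ (hm.const_mul _), lintegral_const_mul' _ _ ENNReal.ofReal_ne_top,
    lintegral_const_mul' _ _ ENNReal.ofReal_ne_top,
    lintegral_add_right_eq_self (fun x => ENNReal.ofReal (η |lam₀ * f x|)) t, ← add_mul,
    ← ENNReal.ofReal_add (by norm_num) (by norm_num)]
  norm_num [orliczModular]

/-- The part of the error coming from the spread of the nodes, split at `|u| ≤ w^(1-α)`. -/
theorem lintegral_fejerKernel_mul_le {J : ℝ → ℝ≥0∞} {ω I : ℝ≥0∞} {α w : ℝ} (hw : 0 < w)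
    (hω : ∀ t, |t| ≤ 1 / w ^ α → J t ≤ ω) (hI : ∀ t, J t ≤ I) :
    ∫⁻ u, ENNReal.ofReal (fejerKernel u) * J (u / w) ≤
      4 * ω + ENNReal.ofReal (2 / w ^ (1 - α)) * I := by
  have hF : Measurable fun u => ENNReal.ofReal (fejerKernel u) :=
    continuous_fejerKernel.measurable.ennreal_ofReal
  have hs : MeasurableSet {u : ℝ | |u| ≤ w ^ (1 - α)} :=
    measurableSet_le _root_.continuous_abs.measurable measurable_const
  rw [← lintegral_add_compl _ hs]
  refine add_le_add ?_ ?_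
  · calc _ ≤ ∫⁻ u in {u : ℝ | |u| ≤ w ^ (1 - α)}, ENNReal.ofReal (fejerKernel u) * ω := by
          refine setLIntegral_mono (hF.mul_const _) fun u hu => mul_le_mul_right (hω _ ?_) _
          -- The threshold `w ^ (1 - α)` equals `w / w ^ α`, so dividing `u` by `w` gives exactly
          -- the range of `ω`.
          rw [Set.mem_ofPred_eq, Real.rpow_sub hw, Real.rpow_one] at hu
          rw [abs_div, abs_of_pos hw, div_le_iff₀ hw]
          exact hu.trans_eq (by ring)
      _ ≤ _ := by
          rw [lintegral_mul_const _ hF]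
          exact mul_le_mul_left ((setLIntegral_le_lintegral _ _).trans lintegral_fejerKernel_le) _
  · calc _ ≤ ∫⁻ u in {u : ℝ | |u| ≤ w ^ (1 - α)}ᶜ, ENNReal.ofReal (fejerKernel u) * I :=
          lintegral_mono fun u => mul_le_mul_right (hI _) _
      _ ≤ _ := by
          rw [lintegral_mul_const _ hF]
          exact mul_le_mul_left (lintegral_fejerKernel_tail_le (Real.rpow_pos_of_pos hw _)) _

theorem IsAdmissibleFamily.deviation_abs_le {g : ℝ → ℝ → ℝ} {ψ : ℝ → ℝ} {θ₀ : ℝ}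
    (hg : IsAdmissibleFamily g ψ θ₀) : ∃ M : ℝ, 0 ≤ M ∧ ∀ᶠ w in atTop, ∀ x u : ℝ, u ≠ 0 →
      |g w u / u * ∑' k : ℤ, fejerKernel (w * x - k) - 1| ≤ M * w ^ (-θ₀) := by
  obtain ⟨M, hM⟩ := hg.deviation
  refine ⟨|M|, abs_nonneg M, ?_⟩
  filter_upwards [hM, eventually_gt_atTop 0] with w hw hw₀ x u hu
  have h := (le_iSup₂ (f := fun (u : ℝ) (_ : u ≠ 0) =>
    ENNReal.ofReal |g w u / u * ∑' k : ℤ, fejerKernel (w * x - k) - 1|) u hu).trans (hw x)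
  have hp := Real.rpow_nonneg hw₀.le (-θ₀)
  exact (ENNReal.ofReal_le_ofReal_iff (by positivity)).1
    (h.trans (ENNReal.ofReal_le_ofReal (mul_le_mul_of_nonneg_right (le_abs_self M) hp)))

/-- The estimate at a fixed `w`. The condition `3 * μ * fejerBound ≤ C` lets (H) convert `φ ∘ ψ`
into `η` in the first two terms; `3 * μ * M ≤ lam₀` handles the third. -/
theorem IsAdmissibleFamily.orliczModular_error_le {g : ℝ → ℝ → ℝ} {ψ φ η f : ℝ → ℝ} {θ₀ : ℝ}
    (hg : IsAdmissibleFamily g ψ θ₀) (hψ : IsPhiFunction ψ)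
    (hφ : IsPhiFunction φ) (hφc : ConvexOn ℝ (Set.Ici 0) φ)
    (hη : IsPhiFunction η) (hηc : ConvexOn ℝ (Set.Ici 0) η)
    (hf : Measurable f) (hfl : LocallyIntegrable f volume)
    {lam lam₀ C M μ α w : ℝ} (hlam₀ : 0 < lam₀)
    (hfin : orliczModular η (fun x => lam₀ * f x) < ∞)
    (hlam : 0 < lam) (hlam' : lam ≤ lam₀ / 2)
    (hC : ∀ u : ℝ, 0 ≤ u → φ (C * ψ u) ≤ η (lam * u)) (hμ : 0 < μ)
    (hμC : 3 * μ * fejerBound ≤ C) (hM₀ : 0 ≤ M) (hμM : 3 * μ * M ≤ lam₀) (hw : 0 < w)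
    (hwθ : w ^ (-θ₀) ≤ 1)
    (hM : ∀ x u : ℝ, u ≠ 0 →
      |g w u / u * ∑' k : ℤ, fejerKernel (w * x - k) - 1| ≤ M * w ^ (-θ₀)) :
    orliczModular φ (fun x => μ * (fejerKantorovich g w f x - f x)) ≤
      (1 / 3 : ℝ≥0∞) *
        (orliczModulus η lam f (1 / w ^ α)
          + ENNReal.ofReal (2 / w ^ (1 - α)) * orliczModular η (fun x => lam₀ * f x)
          + orliczModulus η lam f (1 / w)
          + orliczModular φ (fun x => lam₀ * f x) * ENNReal.ofReal (w ^ (-θ₀))) := by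
  obtain ⟨A, -, hA⟩ := hη.exists_mean_le hηc hfl hlam₀ hfin hw
  have hN : 4 ≤ fejerBound := four_le_fejerBound
  have hN₀ : 0 < fejerBound := by linarith
  set H : ℝ → ℝ → ℝ≥0∞ := fun p q => ENNReal.ofReal (η |lam * (f q - f p)|) with hHdef
  have hHm : Measurable (Function.uncurry H) :=
    (hη.continuous_abs.measurable.comp
      (((hf.comp measurable_snd).sub (hf.comp measurable_fst)).const_mul lam)).ennreal_ofReal
  have hψη : ∀ {r y : ℝ}, 0 ≤ r → r ≤ C →
      ENNReal.ofReal (φ (r * ψ |y|)) ≤ ENNReal.ofReal (η |lam * y|) := fun {r y} hr hrC => by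
    rw [abs_mul, abs_of_pos hlam]
    have h0 := hψ.nonneg (abs_nonneg y)
    exact ENNReal.ofReal_le_ofReal ((hφ.mono (mul_nonneg hr h0)
      (mul_le_mul_of_nonneg_right hrC h0)).trans (hC _ (abs_nonneg y)))
  -- A mean over an interval of the same length as the sampling cells, so that it can be compared
  -- with each sampled mean under a common variable `s`.
  set b : ℝ → ℝ := fun x => w * ∫ s in (0 : ℝ)..1 / w, f (x + s) with hb
  have hii : ∀ x, IntervalIntegrable (fun s => f (x + s)) volume 0 (1 / w) := fun x =>
    (intervalIntegrable_iff_integrableOn_Ioc_of_le (by positivity)).2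
      (LocallyIntegrable.integrableOn_Ioc_shift hfl x (1 / w))
  have hmean : ∀ (x : ℝ) (k : ℤ), ENNReal.ofReal
      (φ (3 * μ * fejerBound * ψ |(w * ∫ u in ((k : ℝ) / w)..(((k : ℝ) + 1) / w), f u) - b x|)) ≤
      ENNReal.ofReal w * ∫⁻ s in Set.Ioc 0 (1 / w), H (k / w + s) (x + s) := fun x k => by
    refine (hψη (by positivity) hμC).trans ?_
    rw [mean_eq_mean_shift, hb, ← mul_sub, ← intervalIntegral.integral_sub (hii _) (hii _)]
    refine (hη.ofReal_map_mean_le hηc hw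
      ((LocallyIntegrable.integrableOn_Ioc_shift hfl _ _).sub
        (LocallyIntegrable.integrableOn_Ioc_shift hfl _ _)) lam).trans (le_of_eq ?_)
    simp only [hHdef, Pi.sub_apply]
    congr 1
    refine lintegral_congr fun s => ?_
    rw [abs_mul, abs_mul, abs_sub_comm]
  have hpoint : ∀ x, ENNReal.ofReal (φ |μ * (fejerKantorovich g w f x - f x)|) ≤
      (1 / 3 : ℝ≥0∞) * (ENNReal.ofReal fejerBound⁻¹ *
          (∑' k : ℤ, ENNReal.ofReal (fejerKernel (w * x - k)) *
            (ENNReal.ofReal w * ∫⁻ s in Set.Ioc 0 (1 / w), H (k / w + s) (x + s)))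
        + ENNReal.ofReal w * (∫⁻ s in Set.Ioc 0 (1 / w), H x (x + s))
        + ENNReal.ofReal (w ^ (-θ₀)) * ENNReal.ofReal (φ |lam₀ * f x|)) := fun x => by
    obtain ⟨hs, hle⟩ := hg.abs_sub_le hψ hw hA x (b x) (hM x)
    have hk₀ : ∀ k : ℤ, 0 ≤ fejerKernel (w * x - k) := fun k => fejerKernel_nonneg _
    have hψ₀ : ∀ y : ℝ, 0 ≤ ψ |y| := fun y => hψ.nonneg (abs_nonneg _)
    have hθ := Real.rpow_nonneg hw.le (-θ₀)
    have hle' := mul_le_mul_of_nonneg_left hle hμ.le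
    rw [mul_add, mul_add] at hle'
    rw [abs_mul, abs_of_pos hμ]
    refine (hφ.map_add_three_le hφc (mul_nonneg hμ.le (abs_nonneg _))
      (mul_nonneg hμ.le (tsum_nonneg fun k => mul_nonneg (hk₀ k) (hψ₀ _)))
      (mul_nonneg hμ.le (mul_nonneg hN₀.le (hψ₀ _))) (by positivity) hle').trans ?_
    refine mul_le_mul_right (add_le_add_three ?_ ?_ ?_) _
    · rw [← mul_assoc]
      refine (hφ.ofReal_map_tsum_le hφc hN₀ hk₀ (summable_fejerKernel _) (tsum_fejerKernel_le _)
        (fun k => hψ₀ _) hs (by positivity)).trans ?_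
      exact mul_le_mul_right (ENNReal.tsum_le_tsum fun k => mul_le_mul_right (hmean x k) _) _
    · have e : b x - f x = w * ∫ s in (0 : ℝ)..1 / w, (f (x + s) - f x) := by
        rw [intervalIntegral.integral_sub (hii x) intervalIntegrable_const, mul_sub,
          intervalIntegral.integral_const, smul_eq_mul, sub_zero, ← mul_assoc,
          mul_one_div_cancel hw.ne', one_mul]
      rw [← mul_assoc, ← mul_assoc]
      refine (hψη (by positivity) hμC).trans ?_
      rw [e]
      exact hη.ofReal_map_mean_le hηc hw
        ((LocallyIntegrable.integrableOn_Ioc_shift hfl _ _).sub (by simp)) lam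
    · rw [← ENNReal.ofReal_mul hθ]
      refine ENNReal.ofReal_le_ofReal (le_trans (hφ.mono (by positivity) ?_)
        (hφ.map_mul_le hφc hθ hwθ (abs_nonneg _)))
      rw [abs_mul, abs_of_pos hlam₀]
      calc 3 * (μ * (M * w ^ (-θ₀) * |f x|)) = 3 * μ * M * (w ^ (-θ₀) * |f x|) := by ring
        _ ≤ lam₀ * (w ^ (-θ₀) * |f x|) := mul_le_mul_of_nonneg_right hμM (by positivity)
        _ = _ := by ring
  have hBm₂ : Measurable fun p : ℝ × ℝ => H p.1 (p.1 + p.2) :=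
    hHm.comp (by fun_prop : Measurable fun p : ℝ × ℝ => (p.1, p.1 + p.2))
  have hBm : Measurable fun x => ENNReal.ofReal w * (∫⁻ s in Set.Ioc 0 (1 / w), H x (x + s)) :=
    hBm₂.lintegral_prod_right'.const_mul _
  have hCm : Measurable fun x => ENNReal.ofReal (w ^ (-θ₀)) * ENNReal.ofReal (φ |lam₀ * f x|) :=
    (hφ.continuous_abs.measurable.comp (hf.const_mul lam₀)).ennreal_ofReal.const_mul _
  have hB : ∫⁻ x, ENNReal.ofReal w * (∫⁻ s in Set.Ioc 0 (1 / w), H x (x + s)) ≤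
      orliczModulus η lam f (1 / w) := by
    -- After Tonelli, each `s` in `(0, 1/w]` contributes at most `ω(f, 1/w)`, and the outer average
    -- has total mass 1.
    rw [lintegral_const_mul' _ _ ENNReal.ofReal_ne_top,
      lintegral_lintegral_swap hBm₂.aemeasurable]
    calc ENNReal.ofReal w * ∫⁻ s in Set.Ioc 0 (1 / w), ∫⁻ x, H x (x + s)
        ≤ ENNReal.ofReal w * ∫⁻ _ in Set.Ioc 0 (1 / w), orliczModulus η lam f (1 / w) := by
          refine mul_le_mul_right (setLIntegral_mono measurable_const fun s hs => ?_) _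
          exact le_iSup₂ (f := fun (t : ℝ) (_ : |t| ≤ 1 / w) =>
            orliczModular η (fun x => lam * (f (x + t) - f x))) s
            (by rw [abs_of_pos hs.1]; exact hs.2)
      _ = orliczModulus η lam f (1 / w) := by
          rw [setLIntegral_const, Real.volume_Ioc, sub_zero, mul_left_comm,
            ← ENNReal.ofReal_mul hw.le, mul_one_div_cancel hw.ne', ENNReal.ofReal_one, mul_one]
  have hNinv : ENNReal.ofReal fejerBound⁻¹ * 4 ≤ 1 := by
    rw [show (4 : ℝ≥0∞) = ENNReal.ofReal 4 by simp, ← ENNReal.ofReal_mul (by positivity)]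
    refine ENNReal.ofReal_le_one.2 ?_
    rw [inv_mul_le_iff₀ hN₀]; linarith
  have hNinv' : ENNReal.ofReal fejerBound⁻¹ ≤ 1 :=
    ENNReal.ofReal_le_one.2 (inv_le_one_of_one_le₀ (by linarith))
  refine (lintegral_mono hpoint).trans ?_
  rw [lintegral_const_mul' _ _ (by simp), lintegral_add_right _ hCm, lintegral_add_right _ hBm,
    lintegral_const_mul' _ _ ENNReal.ofReal_ne_top, lintegral_tsum_fejerKernel_mul_mean hw hHm]
  refine mul_le_mul_right (add_le_add_three ?_ hB
    ((lintegral_const_mul' _ _ ENNReal.ofReal_ne_top).trans (mul_comm _ _)).le) _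
  refine (mul_le_mul_right (lintegral_fejerKernel_mul_le (α := α)
    (ω := orliczModulus η lam f (1 / w ^ α)) (J := fun t => ∫⁻ y, H y (y + t)) hw (fun t ht => ?_)
    (hη.orliczModular_sub_le hηc hf hlam.le hlam')) _).trans ?_
  · exact le_iSup₂ (f := fun (t : ℝ) (_ : |t| ≤ 1 / w ^ α) =>
      orliczModular η (fun x => lam * (f (x + t) - f x))) t ht
  · rw [mul_add, ← mul_assoc]
    exact add_le_add (mul_le_of_le_one_left' hNinv) (mul_le_of_le_one_left' hNinv')

/-- The rate of approximation for a measurable representative. -/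
theorem IsAdmissibleFamily.exists_orliczModular_error_le {g : ℝ → ℝ → ℝ} {ψ φ η f : ℝ → ℝ}
    {θ₀ α ν : ℝ} (hα₁ : α < 1) (hν₁ : ν < 1) (hθ : 0 < θ₀)
    (hg : IsAdmissibleFamily g ψ θ₀) (hψ : IsPhiFunction ψ)
    (hφ : IsPhiFunction φ) (hφc : ConvexOn ℝ (Set.Ici 0) φ)
    (hη : IsPhiFunction η) (hηc : ConvexOn ℝ (Set.Ici 0) η) (hH : ConditionH φ ψ η)
    (hf : Measurable f) (hfl : LocallyIntegrable f volume) {lam₀ : ℝ} (hlam₀ : 0 < lam₀)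
    (hfin : orliczModular η (fun x => lam₀ * f x) < ∞) {lam : ℝ} (hlam : 0 < lam)
    (hlam' : lam < min 1 (lam₀ / 2)) :
    ∃ μ : ℝ, 0 < μ ∧ ∀ᶠ w : ℝ in atTop,
      orliczModular φ (fun x => μ * (fejerKantorovich g w f x - f x)) ≤
        (1 / 3 : ℝ≥0∞) *
          (orliczModulus η lam f (1 / w ^ α)
            + ENNReal.ofReal 2 * orliczModular η (fun x => lam₀ * f x)
                * ENNReal.ofReal (w ^ (-((1 - α) * ν)))
            + orliczModulus η lam f (1 / w)
            + orliczModular φ (fun x => lam₀ * f x) * ENNReal.ofReal (w ^ (-θ₀))) := by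
  rw [lt_min_iff] at hlam'
  obtain ⟨C, hC₀, -, hC⟩ := hH lam hlam hlam'.1
  obtain ⟨M, hM₀, hM⟩ := hg.deviation_abs_le
  have hN₀ : 0 < fejerBound := by linarith [four_le_fejerBound]
  -- The two entries meet the two conditions on `μ`; `M + 1` keeps the denominator positive when `M
  -- = 0`.
  refine ⟨min (C / (3 * fejerBound)) (lam₀ / (3 * (M + 1))), by positivity, ?_⟩
  have hμ : 0 < min (C / (3 * fejerBound)) (lam₀ / (3 * (M + 1))) := by positivity
  have h1 := min_le_left (C / (3 * fejerBound)) (lam₀ / (3 * (M + 1)))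
  have h2 := min_le_right (C / (3 * fejerBound)) (lam₀ / (3 * (M + 1)))
  set μ := min (C / (3 * fejerBound)) (lam₀ / (3 * (M + 1)))
  rw [le_div_iff₀ (by positivity)] at h1 h2
  filter_upwards [hM, eventually_ge_atTop 1] with w hMw hw1
  have hw : 0 < w := by linarith
  refine (hg.orliczModular_error_le (α := α) hψ hφ hφc hη hηc hf hfl hlam₀ hfin hlam hlam'.2.le hC
    hμ (by linarith) hM₀ (by nlinarith) hw
    (Real.rpow_le_one_of_one_le_of_nonpos hw1 (by linarith)) hMw).trans ?_
  refine mul_le_mul_right (add_le_add_left (add_le_add_left (add_le_add_right ?_ _) _) _) _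
  -- The tail decays like `w ^ (-(1 - α))`; for `w ≥ 1` and `ν < 1` this is at most `w ^ (-((1 - α)
  -- * ν))`.
  rw [mul_right_comm, ← ENNReal.ofReal_mul zero_le_two, div_eq_mul_inv, ← Real.rpow_neg hw.le]
  gcongr
  nlinarith

/-! ### Invariance under almost everywhere equality, and the theorem. -/

theorem fejerTerm_congr (g : ℝ → ℝ → ℝ) (w : ℝ) {f f' : ℝ → ℝ} (h : f =ᵐ[volume] f') :
    fejerTerm g w f = fejerTerm g w f' := by
  ext x k
  rw [fejerTerm, fejerTerm, intervalIntegral.integral_congr_ae (h.mono fun u hu _ => hu)]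

theorem orliczModulus_congr (η : ℝ → ℝ) (lam δ : ℝ) {f f' : ℝ → ℝ} (h : f =ᵐ[volume] f') :
    orliczModulus η lam f δ = orliczModulus η lam f' δ := by
  refine iSup_congr fun t => iSup_congr fun _ => orliczModular_congr ?_
  have ht := (measurePreserving_add_right volume t).quasiMeasurePreserving.ae_eq_comp h
  filter_upwards [h, ht] with x hx hxt
  simp only [Function.comp_apply] at hxt
  rw [hx, hxt]

theorem mainTheorem7 (α ν : ℝ) (hα₀ : 0 < α) (hα₁ : α < 1) (hν₀ : 0 < ν) (hν₁ : ν < 1) :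
    ∃ K : ℝ, 0 < K ∧
      ∀ (g : ℝ → ℝ → ℝ) (ψ φ η : ℝ → ℝ) (θ₀ : ℝ) (f : ℝ → ℝ),
        IsPhiFunction ψ → 0 < θ₀ → IsAdmissibleFamily g ψ θ₀ →
        IsPhiFunction φ → ConvexOn ℝ (Set.Ici 0) φ →
        IsPhiFunction η → ConvexOn ℝ (Set.Ici 0) η →
        ConditionH φ ψ η →
        MemOrlicz (fun u => φ u + η u) f →
        LocallyIntegrable f volume ∧
        (∀ w : ℝ, 0 < w → ∀ x : ℝ, Summable (fejerTerm g w f x)) ∧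
        ∀ lam₀ : ℝ, 0 < lam₀ →
          orliczModular (fun u => φ u + η u) (fun x => lam₀ * f x) < ∞ →
          ∀ lam : ℝ, 0 < lam → lam < min 1 (lam₀ / 2) →
          ∃ μ : ℝ, 0 < μ ∧ ∀ᶠ w : ℝ in atTop,
            orliczModular φ (fun x => μ * (fejerKantorovich g w f x - f x)) ≤
              (1 / 3 : ℝ≥0∞) *
                (orliczModulus η lam f (1 / w ^ α)
                  + ENNReal.ofReal K * orliczModular η (fun x => lam₀ * f x)
                      * ENNReal.ofReal (w ^ (-((1 - α) * ν)))
                  + orliczModulus η lam f (1 / w)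
                  + orliczModular φ (fun x => lam₀ * f x) * ENNReal.ofReal (w ^ (-θ₀))) := by
  refine ⟨2, two_pos, fun g ψ φ η θ₀ f hψ hθ hg hφ hφc hη hηc hH hf => ?_⟩
  have hfl : LocallyIntegrable f volume := (hφ.add hη).locallyIntegrable (hφc.add hηc) hf
  have hηfin : ∀ c : ℝ, orliczModular (fun u => φ u + η u) (fun x => c * f x) < ∞ →
      orliczModular η (fun x => c * f x) < ∞ := fun c hc =>
    (lintegral_mono fun x => ENNReal.ofReal_le_ofReal
      (le_add_of_nonneg_left (hφ.nonneg (abs_nonneg _)))).trans_lt hc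
  obtain ⟨hm, c, hc₀, hc⟩ := hf
  refine ⟨hfl, fun w hw x => hg.summable_fejerTerm hψ hη hηc hfl hc₀ (hηfin c hc) hw x,
    fun lam₀ hlam₀ hfin lam hlam hlam' => ?_⟩
  -- The Tonelli arguments were carried out for Borel `f`. Sampled means, modulars and moduli of
  -- continuity do not see null sets, so a Borel representative suffices.
  have hae : f =ᵐ[volume] hm.mk f := hm.ae_eq_mk
  have haec : (fun x => lam₀ * f x) =ᵐ[volume] fun x => lam₀ * hm.mk f x :=
    hae.mono fun x hx => by simp only [hx]
  obtain ⟨μ, hμ, hest⟩ := hg.exists_orliczModular_error_le hα₁ hν₁ hθ hψ hφ hφc hη hηc hH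
    hm.measurable_mk (hfl.congr hae) hlam₀
    (by rw [← orliczModular_congr haec]; exact hηfin lam₀ hfin) hlam hlam'
  refine ⟨μ, hμ, hest.mono fun w hw => ?_⟩
  rw [orliczModular_congr haec, orliczModular_congr haec, orliczModulus_congr η lam _ hae,
    orliczModulus_congr η lam _ hae]
  refine le_trans (le_of_eq (orliczModular_congr (hae.mono fun x hx => ?_))) hw
  simp only [fejerKantorovich, fejerTerm_congr g w hae, hx]
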